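/- Let $d\ge 0$ be an integer and $\alpha>-1/2$. Write points of $\mathbb{R}^{d+1}_+=\mathbb{R}^d\times(0,\infty)$ as $x=(x',x_{d+1})$, put $-x=(-x',x_{d+1})$ and $d\mu_\alpha(x)=x_{d+1}^{2\alpha+1}\,dx$, and let $L^1_\alpha(\mathbb{R}^{d+1}_+)$ be the space of complex-valued functions on $\mathbb{R}^{d+1}_+$ integrable with respect to $\mu_\alpha$. Let $$\Lambda^d_\alpha(x,y)=e^{-i\langle x',y'\rangle}\,j_\alpha(x_{d+1}y_{d+1}),\qquad j_\alpha(s)=\Gamma(\alpha+1)\sum_{k=0}^\infty\frac{(-1)^k s^{2k}}{2^{2k}\,k!\,\Gamma(\alpha+k+1)},$$ $$\mathcal{F}_{W,\alpha}\varphi(y)=\int_{\mathbb{R}^{d+1}_+}\varphi(x)\Lambda^d_\alpha(y,x)\,d\mu_\alpha(x)\quad(\varphi\in L^1_\alpha(\mathbb{R}^{d+1}_+)),\qquad C_{\alpha,d}=\frac{1}{(2\pi)^d\,2^{2\alpha}\,\Gamma(\alpha+1)^2}.$$ Let $\varphi$ belong to the Wiener algebra $\mathcal{A}_\alpha(\mathbb{R}^{d+1}_+)$,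 that is, $\varphi\in L^1_\alpha(\mathbb{R}^{d+1}_+)$ and $\mathcal{F}_{W,\alpha}\varphi\in L^1_\alpha(\mathbb{R}^{d+1}_+)$. Then for almost every $x\in\mathbb{R}^{d+1}_+$ the integral below converges absolutely and $$\varphi(x)=C_{\alpha,d}\int_{\mathbb{R}^{d+1}_+}\mathcal{F}_{W,\alpha}\varphi(y)\,\Lambda^d_\alpha(x,-y)\,d\mu_\alpha(y).$$ -/

import Mathlib

namespace Weinstein

open MeasureTheory

/-- Points `x = (x', x_{d+1})` of `ℝ^d × ℝ`. -/
abbrev Pt (d : ℕ) : Type := EuclideanSpace ℝ (Fin d) × ℝ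

/-- The half space `ℝ^{d+1}_+ = ℝ^d × (0, ∞)`. -/
def halfSpace (d : ℕ) : Set (Pt d) := {x | 0 < x.2}

/-- The reflection written `-x` in the Weinstein setting: `-(x', x_{d+1}) = (-x', x_{d+1})`. -/
def reflect {d : ℕ} (x : Pt d) : Pt d := (-x.1, x.2)

/-- The measure `dμ_α(x) = x_{d+1}^{2α+1} dx` carried by the half space. -/
noncomputable def mu (d : ℕ) (α : ℝ) : Measure (Pt d) :=
  ((volume : Measure (Pt d)).restrict (halfSpace d)).withDensity
    (fun x => ENNReal.ofReal (x.2 ^ (2 * α + 1)))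

/-- The normalized Bessel function
`j_α(s) = Γ(α+1) ∑_k (-1)^k s^{2k} / (2^{2k} k! Γ(α+k+1))`. -/
noncomputable def normBessel (α s : ℝ) : ℝ :=
  Real.Gamma (α + 1) *
    ∑' k : ℕ, (-1 : ℝ) ^ k * s ^ (2 * k) /
      ((2 : ℝ) ^ (2 * k) * (Nat.factorial k : ℝ) * Real.Gamma (α + (k : ℝ) + 1))

/-- The Weinstein kernel `Λ_α^d(x, y) = e^{-i⟨x', y'⟩} j_α(x_{d+1} y_{d+1})`. -/
noncomputable def kernel {d : ℕ} (α : ℝ) (x y : Pt d) : ℂ :=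
  Complex.exp (-Complex.I * ((inner ℝ x.1 y.1 : ℝ) : ℂ)) * ((normBessel α (x.2 * y.2) : ℝ) : ℂ)

/-- The Weinstein transform `F_{W,α} φ (y) = ∫ φ(x) Λ_α^d(y, x) dμ_α(x)`. -/
noncomputable def transform {d : ℕ} (α : ℝ) (φ : Pt d → ℂ) (y : Pt d) : ℂ :=
  ∫ x, φ x * kernel α y x ∂(mu d α)

/-- The Wiener algebra: `φ` and its Weinstein transform are both in `L^1_α(ℝ^{d+1}_+)`.
Values outside the half space play no role, since `mu d α` vanishes there. -/
def wienerAlgebra (d : ℕ) (α : ℝ) : Set (Pt d → ℂ) :=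
  {φ | Integrable φ (mu d α) ∧ Integrable (transform α φ) (mu d α)}

/-- The constant `C_{α,d} = 1 / ((2π)^d 2^{2α} Γ(α+1)^2)`. -/
noncomputable def invConst (d : ℕ) (α : ℝ) : ℝ :=
  1 / ((2 * Real.pi) ^ d * (2 : ℝ) ^ (2 * α) * Real.Gamma (α + 1) ^ 2)

end Weinstein

namespace Weinstein

open MeasureTheory BoundedContinuousFunction ProbabilityTheory Set

/-! The proof tests both sides against modulated Gaussians. The kernel is bounded by 1, because
`j_α` is an average of cosines over a beta distribution (Poisson's formula), so Fubini moves both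
transforms onto the test function. Gaussians can be transformed explicitly: a Fourier integral in
`x'` times a Hankel integral in `x_{d+1}`. Going from `modGauss` to `dualGauss` and back costs
exactly the factor `1 / C_{α,d}`. Hence `φ` and the inversion integral `g` have the same integrals
against every `modGauss a t` with `t > 0` (`integral_invTransform_mul_modGauss`).

Since `modGauss a (n + 1)` is a modulation times the fixed Gaussian `modGauss 0 1`, the integrable
function `(φ - g) * modGauss 0 1` annihilates all modulations. These form a star-closed monoid
separating the points of the half space, so that function vanishes almost everywhere
(`ae_eq_zero_of_forall_integral_mul_eq_zero`). The Gaussian has no zeros, whence `φ = g` almost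
everywhere. -/

/-! ### Integrable functions are determined by a separating star algebra. -/

/-- The star subalgebra of finite linear combinations of a star-closed submonoid. -/
noncomputable def spanStarSubalgebra {X : Type*} [TopologicalSpace X] (S : Submonoid (X →ᵇ ℂ))
    (hS : ∀ g ∈ S, star g ∈ S) : StarSubalgebra ℂ (X →ᵇ ℂ) where
  toSubalgebra := Algebra.adjoin ℂ (S : Set (X →ᵇ ℂ))
  star_mem' {g} hg := by
    change star g ∈ Algebra.adjoin ℂ (S : Set (X →ᵇ ℂ))
    induction hg using Algebra.adjoin_induction with
    | mem x hx => exact Algebra.subset_adjoin (hS x hx)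
    | algebraMap r =>
      rw [← algebraMap_star_comm]
      exact Subalgebra.algebraMap_mem _ _
    | add x y _ _ hx hy => rw [star_add]; exact add_mem hx hy
    | mul x y _ _ hx hy => rw [star_mul]; exact mul_mem hy hx

theorem mem_span_of_mem_spanStarSubalgebra {X : Type*} [TopologicalSpace X]
    {S : Submonoid (X →ᵇ ℂ)} {hS : ∀ g ∈ S, star g ∈ S} {g : X →ᵇ ℂ}
    (hg : g ∈ spanStarSubalgebra S hS) : g ∈ Submodule.span ℂ (S : Set (X →ᵇ ℂ)) := by
  have h : g ∈ Subalgebra.toSubmodule (Algebra.adjoin ℂ (S : Set (X →ᵇ ℂ))) := hg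
  rwa [Algebra.adjoin_eq_span, Submonoid.closure_eq] at h

theorem integrable_bcf_mul {X : Type*} [TopologicalSpace X] [MeasurableSpace X] [BorelSpace X]
    {μ : Measure X} {f : X → ℂ} (hf : Integrable f μ) (g : X →ᵇ ℂ) :
    Integrable (fun x => g x * f x) μ :=
  hf.bdd_mul (c := ‖g‖) g.continuous.measurable.aestronglyMeasurable
    (Filter.Eventually.of_forall g.norm_coe_le_norm)

/-- A real integrable function that annihilates a separating star subalgebra of bounded continuous
functions vanishes almost everywhere. -/
theorem ae_eq_zero_of_real_of_forall_integral_eq_zero {X : Type*} [TopologicalSpace X]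
    [PolishSpace X] [MeasurableSpace X] [BorelSpace X] {μ : Measure X} {f : X → ℝ}
    (hf : Integrable f μ) {A : StarSubalgebra ℂ (X →ᵇ ℂ)}
    (hA : (A.map (toContinuousMapStarₐ ℂ)).SeparatesPoints)
    (h : ∀ g ∈ A, ∫ x, g x * (f x : ℂ) ∂μ = 0) : f =ᵐ[μ] 0 := by
  have hp : AEMeasurable (fun x => ENNReal.ofReal (f x)) μ := hf.aemeasurable.ennreal_ofReal
  have hn : AEMeasurable (fun x => ENNReal.ofReal (-f x)) μ := hf.neg.aemeasurable.ennreal_ofReal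
  have hpi : ∫⁻ x, ENNReal.ofReal (f x) ∂μ ≠ ⊤ := hf.lintegral_lt_top.ne
  have hni : ∫⁻ x, ENNReal.ofReal (-f x) ∂μ ≠ ⊤ := hf.neg.lintegral_lt_top.ne
  have : IsFiniteMeasure (μ.withDensity fun x => ENNReal.ofReal (f x)) :=
    isFiniteMeasure_withDensity hpi
  have : IsFiniteMeasure (μ.withDensity fun x => ENNReal.ofReal (-f x)) :=
    isFiniteMeasure_withDensity hni
  -- The positive and negative parts of `f` are densities of finite measures that agree on `A`; on a
  -- Polish space a separating star algebra determines a finite measure.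
  have key : (μ.withDensity fun x => ENNReal.ofReal (f x)) =
      μ.withDensity fun x => ENNReal.ofReal (-f x) := by
    refine ext_of_forall_mem_subalgebra_integral_eq_of_polish hA fun g hg => ?_
    rw [integral_withDensity_eq_integral_toReal_smul₀ hp (by simp),
      integral_withDensity_eq_integral_toReal_smul₀ hn (by simp), ← sub_eq_zero, ← integral_sub]
    · rw [← h g hg]
      refine integral_congr_ae (Filter.Eventually.of_forall fun x => ?_)
      rcases le_total 0 (f x) with hx | hx
      · simp [ENNReal.toReal_ofReal hx, ENNReal.ofReal_of_nonpos (neg_nonpos.2 hx), mul_comm]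
      · simp [ENNReal.toReal_ofReal (neg_nonneg.2 hx), ENNReal.ofReal_of_nonpos hx, mul_comm]
    · have := integrable_bcf_mul (f := fun x => ((max (f x) 0 : ℝ) : ℂ)) hf.pos_part.ofReal g
      refine this.congr (Filter.Eventually.of_forall fun x => ?_)
      simp [ENNReal.toReal_ofReal', mul_comm]
    · have := integrable_bcf_mul (f := fun x => ((max (-f x) 0 : ℝ) : ℂ)) hf.neg_part.ofReal g
      refine this.congr (Filter.Eventually.of_forall fun x => ?_)
      simp [ENNReal.toReal_ofReal', mul_comm]
  have hae := (withDensity_eq_iff hp hn hpi).1 key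
  filter_upwards [hae] with x hx
  rcases le_total 0 (f x) with h0 | h0
  · rw [ENNReal.ofReal_of_nonpos (neg_nonpos.2 h0), ENNReal.ofReal_eq_zero] at hx
    exact le_antisymm hx h0
  · rw [ENNReal.ofReal_of_nonpos h0, eq_comm, ENNReal.ofReal_eq_zero] at hx
    exact le_antisymm h0 (neg_nonpos.1 hx)

/-- An integrable function that annihilates a star-closed separating monoid of bounded continuous
functions vanishes almost everywhere. -/
theorem ae_eq_zero_of_forall_integral_mul_eq_zero {X : Type*} [TopologicalSpace X]
    [PolishSpace X] [MeasurableSpace X] [BorelSpace X] {μ : Measure X} {f : X → ℂ}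
    (hf : Integrable f μ) (S : Submonoid (X →ᵇ ℂ)) (hS : ∀ g ∈ S, star g ∈ S)
    (hsep : ∀ x y, x ≠ y → ∃ g ∈ S, g x ≠ g y)
    (h : ∀ g ∈ S, ∫ x, g x * f x ∂μ = 0) : f =ᵐ[μ] 0 := by
  set A := spanStarSubalgebra S hS
  have hA : (A.map (toContinuousMapStarₐ ℂ)).SeparatesPoints := by
    intro x y hxy
    obtain ⟨g, hg, hne⟩ := hsep x y hxy
    exact ⟨g, ⟨toContinuousMapStarₐ ℂ g, ⟨g, Algebra.subset_adjoin hg, rfl⟩, rfl⟩, hne⟩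
  have hz : ∀ g ∈ A, ∫ x, g x * f x ∂μ = 0 := by
    intro g hg
    have hg' := mem_span_of_mem_spanStarSubalgebra hg
    clear hg
    induction hg' using Submodule.span_induction with
    | mem g hg => exact h g hg
    | zero => simp
    | add g₁ g₂ _ _ h₁ h₂ =>
      simp only [BoundedContinuousFunction.coe_add, Pi.add_apply, add_mul]
      rw [integral_add (integrable_bcf_mul hf g₁) (integrable_bcf_mul hf g₂), h₁, h₂, add_zero]
    | smul c g _ hg =>
      simp only [BoundedContinuousFunction.coe_smul, smul_eq_mul, mul_assoc]
      rw [integral_const_mul, hg, mul_zero]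
  -- As `A` is star-closed, the conjugate of `f` is annihilated too, hence so are the real and
  -- imaginary parts.
  have hz' : ∀ g ∈ A, ∫ x, g x * star (f x) ∂μ = 0 := by
    intro g hg
    have := congrArg star (hz (star g) (star_mem hg))
    rw [star_zero, Complex.star_def, ← integral_conj] at this
    simpa using this
  have hfs : Integrable (fun x => star (f x)) μ :=
    (starL' ℝ : ℂ ≃L[ℝ] ℂ).toContinuousLinearMap.integrable_comp hf
  have hre : (fun x => (f x).re) =ᵐ[μ] 0 := by
    refine ae_eq_zero_of_real_of_forall_integral_eq_zero hf.re hA fun g hg => ?_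
    have e : ∀ x, g x * ((f x).re : ℂ) = 2⁻¹ * (g x * f x + g x * star (f x)) := fun x => by
      rw [Complex.re_eq_add_conj, Complex.star_def]; ring
    simp only [e]
    rw [integral_const_mul, integral_add (integrable_bcf_mul hf g) (integrable_bcf_mul hfs g),
      hz g hg, hz' g hg]
    simp
  have him : (fun x => (f x).im) =ᵐ[μ] 0 := by
    refine ae_eq_zero_of_real_of_forall_integral_eq_zero hf.im hA fun g hg => ?_
    have e : ∀ x, g x * ((f x).im : ℂ) =
        (2 * Complex.I)⁻¹ * (g x * f x - g x * star (f x)) := fun x => by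
      rw [Complex.im_eq_sub_conj, Complex.star_def]; ring
    simp only [e]
    rw [integral_const_mul, integral_sub (integrable_bcf_mul hf g) (integrable_bcf_mul hfs g),
      hz g hg, hz' g hg]
    simp
  filter_upwards [hre, him] with x h₁ h₂
  exact Complex.ext h₁ h₂

/-! ### Beta moments and Poisson's integral for `j_α`. -/

theorem ae_betaMeasure_mem_Ioo {a b : ℝ} : ∀ᵐ v ∂(betaMeasure a b), v ∈ Ioo (0 : ℝ) 1 := by
  rw [betaMeasure, ae_withDensity_iff (by unfold betaPDF; fun_prop)]
  refine Filter.Eventually.of_forall fun v hv => ?_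
  by_contra hc
  rw [mem_Ioo, not_and_or, not_lt, not_lt] at hc
  rcases hc with hc | hc
  · exact hv (betaPDF_eq_zero_of_nonpos hc)
  · exact hv (betaPDF_eq_zero_of_one_le hc)

/-- The moments of the beta distribution. -/
theorem integral_pow_betaMeasure {a b : ℝ} (ha : 0 < a) (hb : 0 < b) (k : ℕ) :
    ∫ v, v ^ k ∂(betaMeasure a b) = beta (a + k) b / beta a b := by
  have hak : 0 < a + k := by positivity
  have h1 : ∫ v, betaPDFReal (a + k) b v = 1 := by
    rw [integral_eq_lintegral_of_nonneg_ae]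
    · have := lintegral_betaPDF_eq_one hak hb
      unfold betaPDF at this
      rw [this, ENNReal.toReal_one]
    · refine Filter.Eventually.of_forall fun v => ?_
      by_cases hv : v ∈ Ioo (0 : ℝ) 1
      · exact (betaPDFReal_pos hv.1 hv.2 hak hb).le
      · exact (if_neg hv : betaPDFReal (a + k) b v = 0).ge
    · exact (measurable_betaPDFReal _ _).aestronglyMeasurable
  -- Multiplying by `v ^ k` shifts the parameter `a` to `a + k`, up to normalization.
  have hpdf : ∀ v, (betaPDF a b v).toReal • v ^ k =
      beta (a + k) b / beta a b * betaPDFReal (a + k) b v := by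
    intro v
    by_cases hv : 0 < v ∧ v < 1
    · rw [betaPDF, ENNReal.toReal_ofReal (betaPDFReal_pos hv.1 hv.2 ha hb).le, betaPDFReal,
        betaPDFReal, if_pos hv, if_pos hv, show a + k - 1 = a - 1 + k by ring,
        Real.rpow_add_natCast hv.1.ne', smul_eq_mul]
      have h₁ := (beta_pos ha hb).ne'
      have h₂ := (beta_pos hak hb).ne'
      field_simp
    · rw [betaPDF, betaPDFReal, betaPDFReal, if_neg hv, if_neg hv]; simp
  rw [betaMeasure, integral_withDensity_eq_integral_toReal_smul (by unfold betaPDF; fun_prop)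
    (by simp [betaPDF])]
  simp only [hpdf]
  rw [integral_const_mul, h1, mul_one]

/-- Converts the `(2k)!` of the cosine series into the `2^{2k} k!` of the Bessel series. -/
theorem Gamma_nat_add_half_eq (k : ℕ) :
    Real.Gamma (1 / 2 + k) = √Real.pi * (2 * k).factorial / (2 ^ (2 * k) * k.factorial) := by
  induction k with
  | zero => simp [Real.Gamma_one_half_eq, -one_div]
  | succ k ih =>
    rw [show (1 / 2 + ((k + 1 : ℕ) : ℝ)) = (1 / 2 + k) + 1 by push_cast; ring,
      Real.Gamma_add_one (by positivity), ih, show 2 * (k + 1) = 2 * k + 1 + 1 by ring,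
      Nat.factorial_succ, Nat.factorial_succ, Nat.factorial_succ]
    push_cast
    field_simp
    ring

/-- Poisson's integral representation of the normalized Bessel function. -/
theorem normBessel_eq_integral {α : ℝ} (hα : -1 / 2 < α) (s : ℝ) :
    normBessel α s = ∫ v, Real.cos (s * √v) ∂(betaMeasure (1 / 2) (α + 1 / 2)) := by
  have hb : 0 < α + 1 / 2 := by linarith
  have := isProbabilityMeasureBeta one_half_pos hb
  have hs : HasSum (fun k : ℕ => ∫ v, (-1 : ℝ) ^ k * (s * √v) ^ (2 * k) / (2 * k).factorial
        ∂(betaMeasure (1 / 2) (α + 1 / 2)))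
      (∫ v, Real.cos (s * √v) ∂(betaMeasure (1 / 2) (α + 1 / 2))) := by
    -- Since `√v ≤ 1`, the terms of the cosine series are dominated by those of `cosh |s|`.
    refine hasSum_integral_of_dominated_convergence
      (fun k _ => |s| ^ (2 * k) / (2 * k).factorial) (fun k => by fun_prop) (fun k => ?_) ?_ ?_ ?_
    · filter_upwards [ae_betaMeasure_mem_Ioo] with v hv
      have h1 : √v ≤ 1 := Real.sqrt_le_one.2 hv.2.le
      rw [norm_div, norm_mul, norm_pow, norm_pow, norm_neg, norm_one, one_pow, one_mul, norm_mul,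
        Real.norm_natCast, Real.norm_eq_abs, Real.norm_eq_abs, abs_of_nonneg (Real.sqrt_nonneg v)]
      gcongr
      exact mul_le_of_le_one_right (abs_nonneg s) h1
    · exact Filter.Eventually.of_forall fun _ => (Real.hasSum_cosh |s|).summable
    · exact integrable_const _
    · exact Filter.Eventually.of_forall fun v => Real.hasSum_cos _
  rw [← hs.tsum_eq, normBessel, ← tsum_mul_left]
  refine tsum_congr fun k => ?_
  have e : (∫ v, (-1 : ℝ) ^ k * (s * √v) ^ (2 * k) / (2 * k).factorial
        ∂(betaMeasure (1 / 2) (α + 1 / 2))) =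
      ∫ v, ((-1 : ℝ) ^ k * s ^ (2 * k) / (2 * k).factorial) * v ^ k
        ∂(betaMeasure (1 / 2) (α + 1 / 2)) := by
    refine integral_congr_ae ?_
    filter_upwards [ae_betaMeasure_mem_Ioo] with v hv
    rw [mul_pow, pow_mul (√v), Real.sq_sqrt hv.1.le]
    ring
  rw [e, integral_const_mul, integral_pow_betaMeasure one_half_pos hb, beta, beta,
    Gamma_nat_add_half_eq, Real.Gamma_one_half_eq,
    show (1 / 2 + (k : ℝ) + (α + 1 / 2)) = α + k + 1 by ring,
    show (1 / 2 + (α + 1 / 2)) = α + 1 by ring]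
  have h₁ := (Real.Gamma_pos_of_pos hb).ne'
  generalize Real.Gamma (α + 1 / 2) = A at h₁ ⊢
  have h₂ : Real.Gamma (α + k + 1) ≠ 0 :=
    (Real.Gamma_pos_of_pos (by have := k.cast_nonneg (α := ℝ); linarith)).ne'
  have h₃ : Real.Gamma (α + 1) ≠ 0 := (Real.Gamma_pos_of_pos (by linarith)).ne'
  have h₄ : √Real.pi ≠ 0 := by positivity
  field_simp

theorem abs_normBessel_le_one {α : ℝ} (hα : -1 / 2 < α) (s : ℝ) : |normBessel α s| ≤ 1 := by
  have := isProbabilityMeasureBeta one_half_pos (show 0 < α + 1 / 2 by linarith)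
  rw [normBessel_eq_integral hα, ← Real.norm_eq_abs]
  refine (norm_integral_le_of_norm_le_const
    (Filter.Eventually.of_forall fun v => Real.abs_cos_le_one (s * √v))).trans ?_
  rw [probReal_univ, mul_one]

theorem continuous_normBessel {α : ℝ} (hα : -1 / 2 < α) : Continuous (normBessel α) := by
  have := isProbabilityMeasureBeta one_half_pos (show 0 < α + 1 / 2 by linarith)
  rw [funext (normBessel_eq_integral hα)]
  refine continuous_of_dominated (bound := fun _ => 1) (fun s => by fun_prop)
    (fun s => Filter.Eventually.of_forall fun v => Real.abs_cos_le_one (s * √v))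
    (integrable_const _) (Filter.Eventually.of_forall fun v => by fun_prop)

/-! ### The radial measure and the Hankel transform of a Gaussian. -/

/-- The measure `x^{2α+1} dx` on the half line. -/
noncomputable def radial (α : ℝ) : Measure ℝ :=
  ((volume : Measure ℝ).restrict (Ioi 0)).withDensity
    (fun x => ENNReal.ofReal (x ^ (2 * α + 1)))

theorem mu_eq_prod (d : ℕ) (α : ℝ) :
    mu d α = (volume : Measure (EuclideanSpace ℝ (Fin d))).prod (radial α) := by
  have h : halfSpace d = univ ×ˢ Ioi 0 := by ext; simp [halfSpace]
  rw [mu, radial, prod_withDensity_right (by fun_prop), h, Measure.volume_eq_prod,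
    ← Measure.prod_restrict, Measure.restrict_univ]

instance (α : ℝ) : SFinite (radial α) := by unfold radial; infer_instance

instance (d : ℕ) (α : ℝ) : SFinite (mu d α) := by rw [mu_eq_prod]; infer_instance

theorem integral_radial {α : ℝ} (g : ℝ → ℝ) :
    ∫ x, g x ∂(radial α) = ∫ x in Ioi 0, x ^ (2 * α + 1) * g x := by
  rw [radial, integral_withDensity_eq_integral_toReal_smul (by fun_prop) (by simp)]
  refine setIntegral_congr_fun measurableSet_Ioi fun x hx => ?_
  simp only [smul_eq_mul, ENNReal.toReal_ofReal (Real.rpow_nonneg (le_of_lt hx) _)]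

theorem integrable_radial_iff {α : ℝ} {g : ℝ → ℝ} :
    Integrable g (radial α) ↔ IntegrableOn (fun x => x ^ (2 * α + 1) * g x) (Ioi 0) := by
  rw [radial, integrable_withDensity_iff_integrable_smul' (by fun_prop) (by simp)]
  refine integrableOn_congr_fun (fun x hx => ?_) measurableSet_Ioi
  simp only [smul_eq_mul, ENNReal.toReal_ofReal (Real.rpow_nonneg (le_of_lt hx) _)]

theorem rpow_mul_pow_mul {α x : ℝ} (hx : x ∈ Ioi (0 : ℝ)) (k : ℕ) (c : ℝ) :
    x ^ (2 * α + 1) * (x ^ (2 * k) * c) = x ^ (2 * α + 1 + 2 * k) * c := by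
  rw [← mul_assoc, show (2 * α + 1 + 2 * (k : ℝ)) = 2 * α + 1 + ((2 * k : ℕ) : ℝ) by push_cast; ring,
    Real.rpow_add_natCast (ne_of_gt hx)]

theorem integrable_pow_mul_exp_radial {α : ℝ} (hα : -1 < α) {t : ℝ} (ht : 0 < t) (k : ℕ) :
    Integrable (fun x => x ^ (2 * k) * Real.exp (-t * x ^ 2)) (radial α) := by
  have hk := k.cast_nonneg (α := ℝ)
  rw [integrable_radial_iff]
  refine (integrableOn_rpow_mul_exp_neg_mul_sq ht
    (show -1 < 2 * α + 1 + 2 * k by linarith)).congr_fun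
    (fun x hx => (rpow_mul_pow_mul hx k _).symm) measurableSet_Ioi

theorem integral_pow_mul_exp_radial {α : ℝ} (hα : -1 < α) {t : ℝ} (ht : 0 < t) (k : ℕ) :
    ∫ x, x ^ (2 * k) * Real.exp (-t * x ^ 2) ∂(radial α) =
      t ^ (-(α + 1)) / t ^ k * (1 / 2) * Real.Gamma (α + k + 1) := by
  have hk := k.cast_nonneg (α := ℝ)
  rw [integral_radial, setIntegral_congr_fun measurableSet_Ioi
    (fun x hx => rpow_mul_pow_mul hx k _)]
  have := integral_rpow_mul_exp_neg_mul_rpow two_pos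
    (show -1 < 2 * α + 1 + 2 * k by linarith) ht
  simp only [Real.rpow_two] at this
  rw [this, show (-(2 * α + 1 + 2 * (k : ℝ) + 1) / 2) = -(α + 1) - k by ring,
    show ((2 * α + 1 + 2 * (k : ℝ) + 1) / 2) = α + k + 1 by ring, Real.rpow_sub_natCast ht.ne']

/-- The Hankel transform of a Gaussian. -/
theorem integral_normBessel_mul_exp_radial {α : ℝ} (hα : -1 < α) {t : ℝ} (ht : 0 < t) (y : ℝ) :
    ∫ x, normBessel α (y * x) * Real.exp (-t * x ^ 2) ∂(radial α) =
      Real.Gamma (α + 1) / 2 * t ^ (-(α + 1)) * Real.exp (-(1 / (4 * t)) * y ^ 2) := by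
  set c : ℕ → ℝ := fun k => Real.Gamma (α + 1) * ((-1 : ℝ) ^ k * y ^ (2 * k) /
      ((2 : ℝ) ^ (2 * k) * (Nat.factorial k : ℝ) * Real.Gamma (α + (k : ℝ) + 1))) with hc
  have hΓ : ∀ k : ℕ, 0 < Real.Gamma (α + k + 1) := fun k =>
    Real.Gamma_pos_of_pos (by have := k.cast_nonneg (α := ℝ); linarith)
  -- The Gaussian moment cancels `Γ(α+k+1)` in the Bessel coefficient, leaving the exponential
  -- series of `-y²/(4t)`; its absolute convergence also justifies integrating termwise.
  have hF : ∀ k : ℕ, c k * (t ^ (-(α + 1)) / t ^ k * (1 / 2) * Real.Gamma (α + k + 1)) =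
      Real.Gamma (α + 1) / 2 * t ^ (-(α + 1)) *
        ((-(1 / (4 * t)) * y ^ 2) ^ k / k.factorial) := fun k => by
    have := (hΓ k).ne'
    rw [hc, show -(1 / (4 * t)) * y ^ 2 = (-1) * y ^ 2 / (2 ^ 2 * t) by field_simp; ring,
      div_pow, mul_pow, mul_pow, ← pow_mul, ← pow_mul]
    field_simp
  have hsum := hasSum_integral_of_summable_integral_norm (μ := radial α)
    (F := fun k x => c k * (x ^ (2 * k) * Real.exp (-t * x ^ 2)))
    (fun k => (integrable_pow_mul_exp_radial hα ht k).const_mul _) (by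
      refine (summable_congr fun k => ?_).1
        (((Real.summable_pow_div_factorial (-(1 / (4 * t)) * y ^ 2)).mul_left
          (Real.Gamma (α + 1) / 2 * t ^ (-(α + 1)))).norm)
      rw [← hF k, norm_mul, Real.norm_of_nonneg
        (mul_nonneg (by positivity) (hΓ k).le), ← integral_pow_mul_exp_radial hα ht k,
        ← integral_const_mul]
      refine integral_congr_ae (Filter.Eventually.of_forall fun x => ?_)
      simp only [norm_mul, Real.norm_eq_abs, Real.abs_exp]
      rw [abs_of_nonneg (pow_mul x 2 k ▸ by positivity : 0 ≤ x ^ (2 * k))])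
  have hL : ∀ x, normBessel α (y * x) * Real.exp (-t * x ^ 2) =
      ∑' k, c k * (x ^ (2 * k) * Real.exp (-t * x ^ 2)) := fun x => by
    rw [normBessel, ← tsum_mul_left, ← tsum_mul_right]
    refine tsum_congr fun k => ?_
    rw [hc, mul_pow]
    ring
  simp only [hL]
  have hexp : Real.exp (-(1 / (4 * t)) * y ^ 2) =
      ∑' k : ℕ, (-(1 / (4 * t)) * y ^ 2) ^ k / k.factorial := by
    rw [Real.exp_eq_exp_ℝ, NormedSpace.exp_eq_tsum_div]
  rw [← hsum.tsum_eq, hexp, ← tsum_mul_left]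
  refine tsum_congr fun k => ?_
  rw [integral_const_mul, integral_pow_mul_exp_radial hα ht k, hF k]

/-! ### The Weinstein kernel and modulated Gaussians. -/

open scoped RealInnerProductSpace

variable {d : ℕ} {α : ℝ}

theorem norm_kernel_le_one (hα : -1 / 2 < α) (x y : Pt d) : ‖kernel α x y‖ ≤ 1 := by
  rw [kernel, norm_mul, show -Complex.I * ((⟪x.1, y.1⟫ : ℝ) : ℂ) =
    ((-⟪x.1, y.1⟫ : ℝ) : ℂ) * Complex.I by push_cast; ring,
    Complex.norm_exp_ofReal_mul_I, one_mul, Complex.norm_real]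
  exact abs_normBessel_le_one hα _

theorem continuous_kernel_comp (hα : -1 / 2 < α) {Z : Type*} [TopologicalSpace Z]
    {f g : Z → Pt d} (hf : Continuous f) (hg : Continuous g) :
    Continuous fun z => kernel α (f z) (g z) := by
  unfold kernel
  have := continuous_normBessel hα
  fun_prop

theorem continuous_reflect : Continuous (reflect : Pt d → Pt d) := by
  unfold reflect
  fun_prop

/-- A modulated Gaussian on the half space. -/
noncomputable def modGauss (a : EuclideanSpace ℝ (Fin d)) (t : ℝ) (x : Pt d) : ℂ :=
  Complex.exp (-(1 / 2 : ℂ) * ‖x.1‖ ^ 2 + Complex.I * ⟪a, x.1⟫) *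
    ((Real.exp (-t * x.2 ^ 2) : ℝ) : ℂ)

theorem continuous_modGauss (a : EuclideanSpace ℝ (Fin d)) (t : ℝ) :
    Continuous (modGauss a t) := by
  unfold modGauss
  fun_prop

theorem norm_modGauss_le_one (a : EuclideanSpace ℝ (Fin d)) {t : ℝ} (ht : 0 ≤ t) (x : Pt d) :
    ‖modGauss a t x‖ ≤ 1 := by
  rw [modGauss, norm_mul, show (-(1 / 2 : ℂ) * ‖x.1‖ ^ 2 + Complex.I * ⟪a, x.1⟫) =
    ((-(1 / 2) * ‖x.1‖ ^ 2 : ℝ) : ℂ) + ((⟪a, x.1⟫ : ℝ) : ℂ) * Complex.I by push_cast; ring,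
    Complex.exp_add, norm_mul, Complex.norm_exp_ofReal_mul_I, mul_one, ← Complex.ofReal_exp,
    Complex.norm_real, Complex.norm_real, Real.norm_eq_abs, Real.norm_eq_abs, Real.abs_exp,
    Real.abs_exp, ← Real.exp_add, Real.exp_le_one_iff]
  nlinarith [sq_nonneg ‖x.1‖, mul_nonneg ht (sq_nonneg x.2)]

/-- The constant `(2π)^{d/2}`, as the integral of a Gaussian. -/
noncomputable def gaussConst (d : ℕ) : ℂ := (Real.pi / (1 / 2 : ℂ)) ^ ((d : ℂ) / 2)

theorem gaussConst_mul_self (d : ℕ) : gaussConst d * gaussConst d = (2 * Real.pi : ℂ) ^ d := by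
  have h : (Real.pi / (1 / 2 : ℂ)) = 2 * Real.pi := by ring
  rw [gaussConst, h, ← Complex.cpow_add _ _ (by simp [Real.pi_ne_zero]), add_halves,
    Complex.cpow_natCast]

/-- The inverse Weinstein transform of `modGauss a t`, up to a constant. -/
noncomputable def dualGauss (α : ℝ) (a : EuclideanSpace ℝ (Fin d)) (t : ℝ) (y : Pt d) : ℂ :=
  (gaussConst d * Complex.exp (-(1 / 2 : ℂ) * ‖a + y.1‖ ^ 2)) *
    ((Real.Gamma (α + 1) / 2 * t ^ (-(α + 1)) * Real.exp (-(1 / (4 * t)) * y.2 ^ 2) : ℝ) : ℂ)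

theorem integrable_exp_radial (hα : -1 < α) {t : ℝ} (ht : 0 < t) :
    Integrable (fun x => Real.exp (-t * x ^ 2)) (radial α) := by
  simpa using integrable_pow_mul_exp_radial hα ht 0

theorem half_re_pos : 0 < (1 / 2 : ℂ).re := by norm_num

theorem integrable_modGauss (hα : -1 < α) (a : EuclideanSpace ℝ (Fin d)) {t : ℝ} (ht : 0 < t) :
    Integrable (modGauss a t) (mu d α) := by
  rw [mu_eq_prod]
  exact (GaussianFourier.integrable_cexp_neg_mul_sq_norm_add half_re_pos Complex.I a).mul_prod
    (integrable_exp_radial hα ht).ofReal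

theorem integrable_dualGauss (hα : -1 < α) (a : EuclideanSpace ℝ (Fin d)) {t : ℝ} (ht : 0 < t) :
    Integrable (dualGauss α a t) (mu d α) := by
  rw [mu_eq_prod]
  refine Integrable.mul_prod (f := fun v => gaussConst d * Complex.exp (-(1 / 2 : ℂ) * ‖a + v‖ ^ 2))
    (g := fun s => ((Real.Gamma (α + 1) / 2 * t ^ (-(α + 1)) *
      Real.exp (-(1 / (4 * t)) * s ^ 2) : ℝ) : ℂ)) ?_ ?_
  · have := GaussianFourier.integrable_cexp_neg_mul_sq_norm_add half_re_pos 0 a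
    simp only [zero_mul, add_zero] at this
    exact (this.comp_add_left a).const_mul _
  · exact ((integrable_exp_radial hα (by positivity)).const_mul _).ofReal

theorem integral_modGauss_mul_kernel_reflect (hα : -1 < α) (a : EuclideanSpace ℝ (Fin d)) {t : ℝ}
    (ht : 0 < t) (y : Pt d) :
    ∫ x, modGauss a t x * kernel α x (reflect y) ∂(mu d α) = dualGauss α a t y := by
  have e : ∀ x : Pt d, modGauss a t x * kernel α x (reflect y) =
      Complex.exp (-(1 / 2 : ℂ) * ‖x.1‖ ^ 2 + Complex.I * ⟪a + y.1, x.1⟫) *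
      ((normBessel α (y.2 * x.2) * Real.exp (-t * x.2 ^ 2) : ℝ) : ℂ) := fun x => by
    simp only [modGauss, kernel, reflect]
    rw [inner_neg_right, inner_add_left, mul_comm x.2, real_inner_comm y.1 x.1, mul_mul_mul_comm,
      ← Complex.exp_add]
    push_cast
    congr 1
    · congr 1; ring
    · ring
  simp only [e]
  rw [mu_eq_prod, integral_prod_mul
    (fun v => Complex.exp (-(1 / 2 : ℂ) * ‖v‖ ^ 2 + Complex.I * ⟪a + y.1, v⟫))
    (fun s => ((normBessel α (y.2 * s) * Real.exp (-t * s ^ 2) : ℝ) : ℂ)),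
    GaussianFourier.integral_cexp_neg_mul_sq_norm_add half_re_pos, integral_complex_ofReal,
    integral_normBessel_mul_exp_radial hα ht, dualGauss, gaussConst, finrank_euclideanSpace_fin]
  congr 3
  rw [Complex.I_sq]
  ring

/-- Inversion for Gaussians, and the place where `C_{α,d}` is determined. -/
theorem integral_dualGauss_mul_kernel (hα : -1 < α) (a : EuclideanSpace ℝ (Fin d)) {t : ℝ}
    (ht : 0 < t) (x : Pt d) :
    (invConst d α : ℂ) * ∫ y, dualGauss α a t y * kernel α y x ∂(mu d α) = modGauss a t x := by
  have h₁ : ∫ v, Complex.exp (-(1 / 2 : ℂ) * ‖a + v‖ ^ 2) *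
      Complex.exp (-Complex.I * ⟪v, x.1⟫) =
      gaussConst d * Complex.exp (-(1 / 2 : ℂ) * ‖x.1‖ ^ 2 + Complex.I * ⟪a, x.1⟫) := by
    -- Centring the Gaussian turns the shift by `a` into the phase `e^{i⟨a, x'⟩}`.
    rw [← integral_sub_right_eq_self _ a]
    have e : ∀ u : EuclideanSpace ℝ (Fin d), Complex.exp (-(1 / 2 : ℂ) * ‖a + (u - a)‖ ^ 2) *
        Complex.exp (-Complex.I * ⟪u - a, x.1⟫) =
        Complex.exp (-(1 / 2 : ℂ) * ‖u‖ ^ 2 + -Complex.I * ⟪x.1, u⟫) *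
          Complex.exp (Complex.I * ⟪a, x.1⟫) := fun u => by
      rw [add_sub_cancel, inner_sub_left, ← Complex.exp_add, ← Complex.exp_add,
        real_inner_comm x.1 u]
      push_cast
      congr 1
      ring
    simp only [e]
    rw [integral_mul_const, GaussianFourier.integral_cexp_neg_mul_sq_norm_add half_re_pos,
      gaussConst, finrank_euclideanSpace_fin, Complex.exp_add, mul_assoc, neg_sq, Complex.I_sq]
    congr 4
    ring
  have h₂ := integral_normBessel_mul_exp_radial hα (show 0 < 1 / (4 * t) by positivity) x.2
  have e : ∀ y : Pt d, dualGauss α a t y * kernel α y x =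
      gaussConst d * ((Real.Gamma (α + 1) / 2 * t ^ (-(α + 1)) : ℝ) : ℂ) *
      ((Complex.exp (-(1 / 2 : ℂ) * ‖a + y.1‖ ^ 2) * Complex.exp (-Complex.I * ⟪y.1, x.1⟫)) *
      ((normBessel α (x.2 * y.2) * Real.exp (-(1 / (4 * t)) * y.2 ^ 2) : ℝ) : ℂ)) := fun y => by
    simp only [dualGauss, kernel]
    rw [mul_comm x.2]
    push_cast
    ring
  simp only [e]
  rw [integral_const_mul, mu_eq_prod, integral_prod_mul
    (fun v => Complex.exp (-(1 / 2 : ℂ) * ‖a + v‖ ^ 2) * Complex.exp (-Complex.I * ⟪v, x.1⟫))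
    (fun s => ((normBessel α (x.2 * s) * Real.exp (-(1 / (4 * t)) * s ^ 2) : ℝ) : ℂ)),
    h₁, integral_complex_ofReal, h₂, modGauss,
    show 1 / (4 * (1 / (4 * t))) = t by field_simp]
  have hΓ : Real.Gamma (α + 1) ≠ 0 := (Real.Gamma_pos_of_pos (by linarith)).ne'
  -- The widths `t` and `1/(4t)` contribute `(1/4)^{-(α+1)} = 4 · 2^{2α}`, and the two Fourier
  -- integrals contribute `(2π)^d`.
  have hc : invConst d α * (2 * Real.pi) ^ d * (Real.Gamma (α + 1) / 2 * t ^ (-(α + 1))) *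
      (Real.Gamma (α + 1) / 2 * (1 / (4 * t)) ^ (-(α + 1))) = 1 := by
    have h4 : t ^ (-(α + 1)) * (1 / (4 * t)) ^ (-(α + 1)) = 4 * 2 ^ (2 * α) := by
      rw [← Real.mul_rpow ht.le (by positivity), show t * (1 / (4 * t)) = (4 : ℝ)⁻¹ by field_simp,
        Real.inv_rpow (by norm_num), Real.rpow_neg (by norm_num), inv_inv,
        Real.rpow_add_one (by norm_num), Real.rpow_mul (by norm_num)]
      norm_num [mul_comm]
    have hp : (2 * Real.pi) ^ d ≠ 0 := by positivity
    have hq : (2 : ℝ) ^ (2 * α) ≠ 0 := by positivity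
    calc _ = invConst d α * (2 * Real.pi) ^ d * Real.Gamma (α + 1) ^ 2 / 4 *
        (t ^ (-(α + 1)) * (1 / (4 * t)) ^ (-(α + 1))) := by ring
      _ = 1 := by rw [h4, invConst]; field_simp
  have hc' := congrArg (fun r : ℝ => (r : ℂ)) hc
  have hg := gaussConst_mul_self d
  push_cast at hc' ⊢
  rw [← hg] at hc'
  linear_combination (Complex.exp (-(1 / 2 : ℂ) * ‖x.1‖ ^ 2 + Complex.I * ⟪a, x.1⟫) *
    Complex.exp (-t * x.2 ^ 2)) * hc'

/-! ### Fubini duality and the inverse transform. -/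

theorem integrable_mul_prod_of_bounded {K : Pt d → Pt d → ℂ}
    (hK : Continuous fun p : Pt d × Pt d => K p.1 p.2) (hb : ∀ x y, ‖K x y‖ ≤ 1)
    {f g : Pt d → ℂ} (hf : Integrable f (mu d α)) (hg : Integrable g (mu d α)) :
    Integrable (fun p : Pt d × Pt d => K p.1 p.2 * (g p.1 * f p.2)) ((mu d α).prod (mu d α)) :=
  (hg.mul_prod hf).bdd_mul (c := 1) hK.aestronglyMeasurable
    (Filter.Eventually.of_forall fun p => hb p.1 p.2)

theorem integral_integral_kernel_swap {K : Pt d → Pt d → ℂ}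
    (hK : Continuous fun p : Pt d × Pt d => K p.1 p.2) (hb : ∀ x y, ‖K x y‖ ≤ 1)
    {f g : Pt d → ℂ} (hf : Integrable f (mu d α)) (hg : Integrable g (mu d α)) :
    ∫ x, (∫ y, f y * K x y ∂(mu d α)) * g x ∂(mu d α) =
      ∫ y, f y * ∫ x, g x * K x y ∂(mu d α) ∂(mu d α) := by
  simp only [← integral_const_mul, ← integral_mul_const]
  rw [integral_integral_swap]
  · refine integral_congr_ae (Filter.Eventually.of_forall fun y => integral_congr_ae
      (Filter.Eventually.of_forall fun x => ?_))
    ring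
  · refine (integrable_mul_prod_of_bounded hK hb hf hg).congr
      (Filter.Eventually.of_forall fun p => ?_)
    simp only [Function.uncurry]
    ring

/-- The inverse Weinstein transform, without the normalizing constant. -/
noncomputable def invTransform (α : ℝ) (ψ : Pt d → ℂ) (x : Pt d) : ℂ :=
  ∫ y, ψ y * kernel α x (reflect y) ∂(mu d α)

theorem integrable_mul_kernel (hα : -1 / 2 < α) {ψ : Pt d → ℂ} (hψ : Integrable ψ (mu d α))
    (x : Pt d) : Integrable (fun y => ψ y * kernel α x (reflect y)) (mu d α) :=
  hψ.mul_bdd (c := 1) ((continuous_kernel_comp hα continuous_const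
    continuous_reflect).aestronglyMeasurable)
    (Filter.Eventually.of_forall fun y => norm_kernel_le_one hα x (reflect y))

theorem continuous_invTransform (hα : -1 / 2 < α) {ψ : Pt d → ℂ} (hψ : Integrable ψ (mu d α)) :
    Continuous (invTransform α ψ) := by
  refine continuous_of_dominated (bound := fun y => ‖ψ y‖)
    (fun x => (integrable_mul_kernel hα hψ x).aestronglyMeasurable)
    (fun x => Filter.Eventually.of_forall fun y => ?_) hψ.norm
    (Filter.Eventually.of_forall fun y => continuous_const.mul
      (continuous_kernel_comp hα continuous_id continuous_const))
  rw [norm_mul]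
  exact mul_le_of_le_one_right (norm_nonneg _) (norm_kernel_le_one hα _ _)

theorem norm_invTransform_le (hα : -1 / 2 < α) (ψ : Pt d → ℂ) (hψ : Integrable ψ (mu d α))
    (x : Pt d) : ‖invTransform α ψ x‖ ≤ ∫ y, ‖ψ y‖ ∂(mu d α) := by
  refine norm_integral_le_of_norm_le hψ.norm (Filter.Eventually.of_forall fun y => ?_)
  rw [norm_mul]
  exact mul_le_of_le_one_right (norm_nonneg _) (norm_kernel_le_one hα _ _)

/-- Fubini is applied twice: the inverse transform turns `modGauss` into `dualGauss`, and the direct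
transform turns it back. -/
theorem integral_invTransform_mul_modGauss (hα : -1 / 2 < α) {φ : Pt d → ℂ}
    (hφ : φ ∈ wienerAlgebra d α) (a : EuclideanSpace ℝ (Fin d)) {t : ℝ} (ht : 0 < t) :
    (invConst d α : ℂ) * ∫ x, invTransform α (transform α φ) x * modGauss a t x ∂(mu d α) =
      ∫ x, φ x * modGauss a t x ∂(mu d α) := by
  have hα' : -1 < α := by linarith
  have s₁ := integral_integral_kernel_swap (K := fun x y => kernel α x (reflect y))
    (continuous_kernel_comp hα continuous_fst (continuous_reflect.comp continuous_snd))
    (fun x y => norm_kernel_le_one hα x _) hφ.2 (integrable_modGauss hα' a ht)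
  have s₂ := integral_integral_kernel_swap (K := fun x y => kernel α x y) 
    (continuous_kernel_comp hα continuous_fst continuous_snd)
    (fun x y => norm_kernel_le_one hα x y) hφ.1 (integrable_dualGauss hα' a ht)
  simp only [integral_modGauss_mul_kernel_reflect hα' a ht] at s₁
  simp only [invTransform]
  rw [s₁]
  simp only [transform]
  rw [s₂, ← integral_const_mul]
  refine integral_congr_ae (Filter.Eventually.of_forall fun x => ?_)
  simp only
  rw [← integral_dualGauss_mul_kernel hα' a ht x]
  ring

/-! ### Modulations separate the points of the half space. -/

theorem isOpen_halfSpace : IsOpen (halfSpace d) := isOpen_lt continuous_const continuous_snd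

theorem ae_mem_halfSpace : ∀ᵐ x ∂(mu d α), x ∈ halfSpace d :=
  (withDensity_absolutelyContinuous _ _).ae_le (ae_restrict_mem isOpen_halfSpace.measurableSet)

/-- Allows working on the half space as a Polish space of its own: the modulations, even in
`x_{d+1}`, do not separate the points of `Pt d`. -/
theorem map_comap_mu :
    ((mu d α).comap ((↑) : halfSpace d → Pt d)).map (↑) = mu d α := by
  rw [map_comap_subtype_coe isOpen_halfSpace.measurableSet,
    Measure.restrict_eq_self_of_ae_mem ae_mem_halfSpace]

/-- The multiplier `e^{i⟨a, x'⟩} e^{-n x_{d+1}^2}`. -/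
noncomputable def modulation (a : EuclideanSpace ℝ (Fin d)) (n : ℕ) (x : Pt d) : ℂ :=
  Complex.exp (((⟪a, x.1⟫ : ℝ) : ℂ) * Complex.I) * ((Real.exp (-n * x.2 ^ 2) : ℝ) : ℂ)

theorem norm_modulation_le_one (a : EuclideanSpace ℝ (Fin d)) (n : ℕ) (x : Pt d) :
    ‖modulation a n x‖ ≤ 1 := by
  rw [modulation, norm_mul, Complex.norm_exp_ofReal_mul_I, one_mul, Complex.norm_real,
    Real.norm_eq_abs, Real.abs_exp, Real.exp_le_one_iff, neg_mul, neg_nonpos]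
  positivity

theorem continuous_modulation (a : EuclideanSpace ℝ (Fin d)) (n : ℕ) :
    Continuous (modulation a n) := by
  unfold modulation
  fun_prop

theorem modulation_mul_modGauss (a : EuclideanSpace ℝ (Fin d)) (n : ℕ) (x : Pt d) :
    modulation a n x * modGauss 0 1 x = modGauss a (n + 1) x := by
  rw [modulation, modGauss, modGauss, mul_mul_mul_comm, ← Complex.exp_add, ← Complex.ofReal_mul,
    ← Real.exp_add, inner_zero_left]
  congr 2
  · push_cast; ring
  · congr 1; ring

/-- The monoid of modulations, as bounded continuous functions on the half space. -/
def modulationMonoid (d : ℕ) : Submonoid (halfSpace d →ᵇ ℂ) where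
  carrier := {g | ∃ (a : EuclideanSpace ℝ (Fin d)) (n : ℕ),
    ∀ x : halfSpace d, g x = modulation a n x}
  one_mem' := ⟨0, 0, fun x => by simp [modulation]⟩
  mul_mem' := by
    rintro g₁ g₂ ⟨a, n, h₁⟩ ⟨b, m, h₂⟩
    refine ⟨a + b, n + m, fun x => ?_⟩
    rw [BoundedContinuousFunction.mul_apply, h₁, h₂, modulation, modulation, modulation,
      mul_mul_mul_comm, ← Complex.exp_add, ← Complex.ofReal_mul, ← Real.exp_add, inner_add_left]
    congr 2
    · push_cast; ring
    · congr 1; push_cast; ring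

theorem star_mem_modulationMonoid (g : halfSpace d →ᵇ ℂ) (hg : g ∈ modulationMonoid d) :
    star g ∈ modulationMonoid d := by
  obtain ⟨a, n, h⟩ := hg
  refine ⟨-a, n, fun x => ?_⟩
  rw [BoundedContinuousFunction.star_apply, h, modulation, modulation, Complex.star_def, map_mul,
    Complex.conj_ofReal, ← Complex.exp_conj, map_mul, Complex.conj_ofReal, Complex.conj_I,
    inner_neg_left]
  congr 2
  push_cast
  ring

theorem modulationMonoid_separates (x y : halfSpace d) (hxy : x ≠ y) :
    ∃ g ∈ modulationMonoid d, g x ≠ g y := by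
  suffices h : ∃ a n, modulation a n (x : Pt d) ≠ modulation a n y by
    obtain ⟨a, n, h⟩ := h
    exact ⟨BoundedContinuousFunction.ofNormedAddCommGroup (fun z : halfSpace d => modulation a n z)
      ((continuous_modulation a n).comp continuous_subtype_val) 1
      (fun z => norm_modulation_le_one a n z), ⟨a, n, fun z => rfl⟩, h⟩
  obtain ⟨⟨u, s⟩, hs⟩ := x
  obtain ⟨⟨v, r⟩, hr⟩ := y
  have hs : 0 < s := hs
  have hr : 0 < r := hr
  by_cases hsr : s = r
  · subst hsr
    have huv : u - v ≠ 0 := fun h => hxy (by rw [sub_eq_zero.1 h])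
    -- This frequency has inner product `π` with `u - v`, so the two phases differ by the factor
    -- `-1`.
    refine ⟨(Real.pi / ‖u - v‖ ^ 2) • (u - v), 0, fun h => ?_⟩
    simp only [modulation, Nat.cast_zero, neg_zero, zero_mul, Real.exp_zero, Complex.ofReal_one,
      mul_one] at h
    rw [show u = v + (u - v) by abel, add_sub_cancel_left, inner_add_right, Complex.ofReal_add,
      add_mul, Complex.exp_add, real_inner_smul_left (u - v) (u - v), real_inner_self_eq_norm_sq,
      div_mul_cancel₀ _ (by simpa using huv), Complex.exp_pi_mul_I] at h
    have := mul_left_cancel₀ (Complex.exp_ne_zero _) (h.trans (mul_one _).symm)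
    norm_num at this
  · refine ⟨0, 1, fun h => hsr ?_⟩
    simp only [modulation, inner_zero_left, Complex.ofReal_zero, zero_mul, Complex.exp_zero,
      one_mul, Complex.ofReal_inj, Real.exp_eq_exp, Nat.cast_one, neg_mul, neg_inj] at h
    exact (pow_left_inj₀ hs.le hr.le two_ne_zero).1 h

/-- An integrable function on the half space that annihilates all modulations vanishes. -/
theorem ae_eq_zero_of_forall_integral_modulation_mul_eq_zero {f : Pt d → ℂ}
    (hf : Integrable f (mu d α))
    (h : ∀ a n, ∫ x, modulation a n x * f x ∂(mu d α) = 0) : f =ᵐ[mu d α] 0 := by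
  have : PolishSpace (halfSpace d) := isOpen_halfSpace.polishSpace
  have he : MeasurableEmbedding ((↑) : halfSpace d → Pt d) :=
    MeasurableEmbedding.subtype_coe isOpen_halfSpace.measurableSet
  rw [← map_comap_mu, he.integrable_map_iff] at hf
  have := ae_eq_zero_of_forall_integral_mul_eq_zero hf (modulationMonoid d)
    star_mem_modulationMonoid modulationMonoid_separates (by
      rintro g ⟨a, n, hg⟩
      rw [← h a n]
      conv_rhs => rw [← map_comap_mu, he.integral_map]
      simp only [hg, Function.comp])
  rw [← map_comap_mu, Filter.EventuallyEq, he.ae_map_iff]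
  exact this

end Weinstein

/-! ### The inversion theorem. -/

theorem mainTheorem6 (d : ℕ) (α : ℝ) (hα : -1 / 2 < α)
    (φ : Weinstein.Pt d → ℂ) (hφ : φ ∈ Weinstein.wienerAlgebra d α) :
    ∀ᵐ x ∂(Weinstein.mu d α),
      MeasureTheory.Integrable
        (fun y => Weinstein.transform α φ y * Weinstein.kernel α x (Weinstein.reflect y))
        (Weinstein.mu d α) ∧
      φ x = (Weinstein.invConst d α : ℂ) *
        ∫ y, Weinstein.transform α φ y * Weinstein.kernel α x (Weinstein.reflect y)
          ∂(Weinstein.mu d α) := by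
  have hα' : -1 < α := by linarith
  have hg := Weinstein.continuous_invTransform hα hφ.2
  have hφm : ∀ a : EuclideanSpace ℝ (Fin d), ∀ t : ℝ, 0 < t → MeasureTheory.Integrable
      (fun x => φ x * Weinstein.modGauss a t x) (Weinstein.mu d α) := fun a t ht =>
    hφ.1.mul_bdd (c := 1) (Weinstein.continuous_modGauss a t).aestronglyMeasurable
      (Filter.Eventually.of_forall (Weinstein.norm_modGauss_le_one a ht.le))
  have hgm : ∀ a : EuclideanSpace ℝ (Fin d), ∀ t : ℝ, 0 < t → MeasureTheory.Integrable
      (fun x => Weinstein.invTransform α (Weinstein.transform α φ) x * Weinstein.modGauss a t x)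
      (Weinstein.mu d α) := fun a t ht =>
    (Weinstein.integrable_modGauss hα' a ht).bdd_mul hg.aestronglyMeasurable
      (Filter.Eventually.of_forall (Weinstein.norm_invTransform_le hα _ hφ.2))
  -- The inverse transform is only known to be bounded, so the factor `modGauss 0 1` supplies
  -- integrability; it also keeps the width `n + 1` positive when `n = 0`.
  have h0 := Weinstein.ae_eq_zero_of_forall_integral_modulation_mul_eq_zero
    (f := fun x => φ x * Weinstein.modGauss 0 1 x - (Weinstein.invConst d α : ℂ) *
      (Weinstein.invTransform α (Weinstein.transform α φ) x * Weinstein.modGauss 0 1 x))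
    ((hφm 0 1 one_pos).sub ((hgm 0 1 one_pos).const_mul _)) (fun a n => by
      have ht : (0 : ℝ) < n + 1 := by positivity
      have e : ∀ x, Weinstein.modulation a n x * (φ x * Weinstein.modGauss 0 1 x -
          (Weinstein.invConst d α : ℂ) * (Weinstein.invTransform α (Weinstein.transform α φ) x *
            Weinstein.modGauss 0 1 x)) = φ x * Weinstein.modGauss a (n + 1) x -
          (Weinstein.invConst d α : ℂ) * (Weinstein.invTransform α (Weinstein.transform α φ) x *
            Weinstein.modGauss a (n + 1) x) := fun x => by
        rw [← Weinstein.modulation_mul_modGauss]; ring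
      simp only [e]
      rw [MeasureTheory.integral_sub (hφm a _ ht) ((hgm a _ ht).const_mul _),
        MeasureTheory.integral_const_mul,
        Weinstein.integral_invTransform_mul_modGauss hα hφ a ht, sub_self])
  filter_upwards [h0] with x hx
  refine ⟨Weinstein.integrable_mul_kernel hα hφ.2 x, ?_⟩
  have hne : Weinstein.modGauss (0 : EuclideanSpace ℝ (Fin d)) 1 x ≠ 0 :=
    mul_ne_zero (Complex.exp_ne_zero _) (Complex.ofReal_ne_zero.2 (Real.exp_ne_zero _))
  refine mul_right_cancel₀ hne ?_
  rw [mul_assoc]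
  exact sub_eq_zero.1 hx
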